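/- Theorem 4.1 (comparison principle). Let $1/2<s<1$. For $w:\mathbb R^n\to\mathbb R$ put $$\mathcal D_s w(x)=\inf\Big\{\tfrac12\int_{\mathbb R^n}\frac{w(x+y)+w(x-y)-2w(x)}{|A^{-1}y|^{n+2s}}\,dy\ :\ A \text{ a symmetric positive definite } n\times n \text{ matrix},\ \det A=1\Big\},$$ with values in $[-\infty,\infty]$; $\mathcal D_s w(x)$ is said to be defined if none of these integrals is of the form $\infty-\infty$. For $f:\mathbb R^n\to\mathbb R$, an upper (resp. lower) semicontinuous function $u:\mathbb R^n\to\mathbb R$ satisfies $\mathcal D_s u\ge f$ (resp. $\mathcal D_s u\le f$) in $\mathbb R^n$ in the viscosity sense if, for every $x\in\mathbb R^n$, every open neighborhood $N$ of $x$ and every function $\psi$ of class $C^2$ in $\overline N$ (that is, on an open set containing $\overline N$) with $\psi(x)=u(x)$ and $\psi(y)>u(y)$ (resp. $\psi(y)<u(y)$) for all $y\in N\setminus\{x\}$, the function $w$ equal to $\psi$ in $N$ and to $u$ in $\mathbb R^n\setminus N$ is such that $\mathcal D_s w(x)$ is defined and $\mathcal D_s w(x)\ge f(x)$ (resp. $\mathcal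 D_s w(x)\le f(x)$). Let $g:\mathbb R^n\times\mathbb R\to\mathbb R$ be continuous and suppose that, for some $\mu>0$, $$g(x,t_1)-g(x,t_2)\ge\mu\,(t_1-t_2)\qquad\text{for all }x\in\mathbb R^n\text{ and all real } t_1\ge t_2.$$ Let $\phi:\mathbb R^n\to\mathbb R$ be of class $C^{2,\alpha}$ for some $0<\alpha\le1$ (that is, $C^2$ with $D^2\phi$ Hölder continuous of exponent $\alpha$ on every ball), with at most linear growth: $|\phi(x)|\le C(1+|x|)$ for some constant $C$. Let $u$ be upper semicontinuous and $v$ lower semicontinuous with $$\mathcal D_s u\ge g(x,u(x))\quad\text{and}\quad \mathcal D_s v\le g(x,v(x))\qquad\text{in }\mathbb R^n\text{ in the viscosity sense},$$ and suppose that $(u-\phi)(x)\to0$ and $(v-\phi)(x)\to0$ as $|x|\to\infty$. Then $u\le v$ in $\mathbb R^n$. -/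

import Mathlib

open MeasureTheory Filter Topology
open scoped ENNReal NNReal

noncomputable section

namespace FracMA

/-- Euclidean space `ℝⁿ`. -/
abbrev E (n : ℕ) : Type := EuclideanSpace ℝ (Fin n)

/-- The second-order increment `δ(w,x,y) = w(x+y) + w(x-y) - 2w(x)`. -/
def secondIncr {n : ℕ} (w : E n → ℝ) (x y : E n) : ℝ :=
  w (x + y) + w (x - y) - 2 * w x

/-- The integrand `(1/2) δ(w,x,y) / |A⁻¹ y|^(n+2s)` of the linear operator `L_A`. -/
def integrandLA {n : ℕ} (s : ℝ) (A : Matrix (Fin n) (Fin n) ℝ) (w : E n → ℝ) (x y : E n) : ℝ :=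
  1 / 2 * (secondIncr w x y / ‖Matrix.toEuclideanLin A⁻¹ y‖ ^ ((n : ℝ) + 2 * s))

/-- The integral of the positive part of the integrand of `L_A w(x)`. -/
def posIntegral {n : ℕ} (s : ℝ) (A : Matrix (Fin n) (Fin n) ℝ) (w : E n → ℝ) (x : E n) : ℝ≥0∞ :=
  ∫⁻ y, ENNReal.ofReal (integrandLA s A w x y)

/-- The integral of the negative part of the integrand of `L_A w(x)`. -/
def negIntegral {n : ℕ} (s : ℝ) (A : Matrix (Fin n) (Fin n) ℝ) (w : E n → ℝ) (x : E n) : ℝ≥0∞ :=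
  ∫⁻ y, ENNReal.ofReal (-integrandLA s A w x y)

/-- `L_A w(x) = (1/2) ∫ δ(w,x,y) / |A⁻¹ y|^(n+2s) dy`, as an extended real number. It is
meaningful when at least one of the two integrals is finite, see `DsDefined`. -/
def LA {n : ℕ} (s : ℝ) (A : Matrix (Fin n) (Fin n) ℝ) (w : E n → ℝ) (x : E n) : EReal :=
  (posIntegral s A w x : EReal) - (negIntegral s A w x : EReal)

/-- The admissible matrices: symmetric positive definite with determinant one. -/
def Admissible {n : ℕ} (A : Matrix (Fin n) (Fin n) ℝ) : Prop :=
  A.PosDef ∧ A.det = 1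

/-- The fractional Monge-Ampere operator `D_s w(x) = inf_A L_A w(x)`. -/
def Ds {n : ℕ} (s : ℝ) (w : E n → ℝ) (x : E n) : EReal :=
  ⨅ A : {A : Matrix (Fin n) (Fin n) ℝ // Admissible A}, LA s A.1 w x

/-- All the integrals in `D_s w(x)` exist in the extended sense: none is `∞ - ∞`. -/
def DsDefined {n : ℕ} (s : ℝ) (w : E n → ℝ) (x : E n) : Prop :=
  ∀ A : Matrix (Fin n) (Fin n) ℝ, Admissible A →
    posIntegral s A w x ≠ ∞ ∨ negIntegral s A w x ≠ ∞

/-- `ψ` is of class `C²` in the closure of `N`, i.e. on an open set containing it. -/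
def C2OnClosure {n : ℕ} (ψ : E n → ℝ) (N : Set (E n)) : Prop :=
  ∃ U : Set (E n), IsOpen U ∧ closure N ⊆ U ∧ ContDiffOn ℝ 2 ψ U

open Classical in
/-- The function equal to `ψ` in `N` and to `u` outside `N`. -/
def glue {n : ℕ} (N : Set (E n)) (ψ u : E n → ℝ) : E n → ℝ :=
  fun y => if y ∈ N then ψ y else u y

/-- `u` is a viscosity subsolution of `D_s u = f` in `ℝⁿ`, i.e. `D_s u ≥ f`. -/
def IsViscositySubsolution {n : ℕ} (s : ℝ) (f u : E n → ℝ) : Prop :=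
  UpperSemicontinuous u ∧
    ∀ (x : E n) (N : Set (E n)) (ψ : E n → ℝ), IsOpen N → x ∈ N → C2OnClosure ψ N →
      ψ x = u x → (∀ y ∈ N \ {x}, u y < ψ y) →
        DsDefined s (glue N ψ u) x ∧ (f x : EReal) ≤ Ds s (glue N ψ u) x

/-- `v` is a viscosity supersolution of `D_s v = f` in `ℝⁿ`, i.e. `D_s v ≤ f`. -/
def IsViscositySupersolution {n : ℕ} (s : ℝ) (f v : E n → ℝ) : Prop :=
  LowerSemicontinuous v ∧
    ∀ (x : E n) (N : Set (E n)) (ψ : E n → ℝ), IsOpen N → x ∈ N → C2OnClosure ψ N →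
      ψ x = v x → (∀ y ∈ N \ {x}, ψ y < v y) →
        DsDefined s (glue N ψ v) x ∧ Ds s (glue N ψ v) x ≤ (f x : EReal)

/-- `φ` is of class `C^{2,α}`: it is `C²` and its second derivative is Hölder continuous with
exponent `α` on every ball. -/
def IsC2Alpha {n : ℕ} (α : ℝ≥0) (φ : E n → ℝ) : Prop :=
  ContDiff ℝ 2 φ ∧
    ∀ R : ℝ, ∃ C : ℝ≥0, HolderOnWith C α (iteratedFDeriv ℝ 2 φ) (Metric.ball 0 R)

/-- `φ` grows at most linearly at infinity. -/
def HasLinearGrowth {n : ℕ} (φ : E n → ℝ) : Prop :=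
  ∃ C : ℝ, ∀ x, |φ x| ≤ C * (1 + ‖x‖)

end FracMA

end

noncomputable section

namespace FracMA

/-! The proof doubles variables: `u(a) + θ h(a) - v(b) - β|a - b|²` is maximized over a large
compact ball, with `h = truncSq R` bounded and equal to `|a|²` near the relevant points. At a
maximum point `(x, y)`, equal shifts keep the penalty unchanged, so the increments of `u` at `x` and
`v` at `y` are ordered, with a gain of `2θ|z|²` for `|z| < R` supplied by `h`. Two errors remain: a
quadratic one for `|z| < r`, where `C²` test functions replace `u` and `v`, and a linear one for
`|z| > ρ`, where shifts leave the ball.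

The infimum over `A` is not uniformly elliptic, so errors must be beaten for every `A` at once. All
the profiles are radial and every kernel is homogeneous of degree `-(n+2s)`; in polar coordinates
`A` enters only through one common spherical factor, and a single inequality with weight `t^(-1-2s)`
suffices. Since `1/2 < s < 1`, both errors vanish as `ρ → ∞` and `r → 0`. Here `ρ` does not depend
on `β`, which can therefore tend to infinity over a fixed ball; strict monotonicity of `g` then
gives a contradiction (`exists_radius_rhs_le_of_doubled_max`). -/

/-! ### Kernels in polar coordinates -/

/-- Polar coordinates for the product of a radial function and a homogeneous one. -/
theorem lintegral_radial_mul_homogeneous {F : Type*} [NormedAddCommGroup F] [NormedSpace ℝ F]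
    [FiniteDimensional ℝ F] [Nontrivial F] [MeasurableSpace F] [BorelSpace F]
    (ν : Measure F) [ν.IsAddHaarMeasure] (p : ℝ) {κ : F → ℝ≥0∞} (hκ : Measurable κ)
    (hom : ∀ t : ℝ, 0 < t → ∀ z, κ (t • z) = ENNReal.ofReal (t ^ (-p)) * κ z)
    {f : ℝ → ℝ≥0∞} (hf : Measurable f) :
    ∫⁻ z, f ‖z‖ * κ z ∂ν = (∫⁻ σ : Metric.sphere (0 : F) 1, κ σ ∂ν.toSphere) *
      ∫⁻ t in Set.Ioi (0 : ℝ), ENNReal.ofReal (t ^ (Module.finrank ℝ F - 1)) *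
        (ENNReal.ofReal (t ^ (-p)) * f t) := by
  have key : ∀ x : ({(0 : F)}ᶜ : Set F), f ‖x.1‖ * κ x.1 =
      (fun q : Metric.sphere (0 : F) 1 × Set.Ioi (0 : ℝ) =>
        κ q.1 * (ENNReal.ofReal (q.2.1 ^ (-p)) * f q.2.1)) (homeomorphUnitSphereProd F x) := by
    intro x
    have hx : 0 < ‖x.1‖ := norm_pos_iff.2 x.2
    have h1 := hom ‖x.1‖ hx (‖x.1‖⁻¹ • x.1)
    rw [smul_smul, mul_inv_cancel₀ hx.ne', one_smul] at h1
    simp only [homeomorphUnitSphereProd_apply_fst_coe, homeomorphUnitSphereProd_apply_snd_coe]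
    rw [h1]
    ring
  calc ∫⁻ z, f ‖z‖ * κ z ∂ν
      = ∫⁻ x : ({(0 : F)}ᶜ : Set F), f ‖x.1‖ * κ x.1 ∂(ν.comap (↑)) := by
        rw [lintegral_subtype_comap (measurableSet_singleton _).compl fun x => f ‖x‖ * κ x,
          restrict_compl_singleton]
    _ = ∫⁻ q : Metric.sphere (0 : F) 1 × Set.Ioi (0 : ℝ),
          κ q.1 * (ENNReal.ofReal (q.2.1 ^ (-p)) * f q.2.1)
          ∂(ν.toSphere.prod (.volumeIoiPow (Module.finrank ℝ F - 1))) := by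
        rw [lintegral_congr key]
        exact ν.measurePreserving_homeomorphUnitSphereProd.lintegral_comp_emb
          (Homeomorph.measurableEmbedding _)
          (fun q : Metric.sphere (0 : F) 1 × Set.Ioi (0 : ℝ) =>
            κ q.1 * (ENNReal.ofReal (q.2.1 ^ (-p)) * f q.2.1))
    _ = (∫⁻ σ : Metric.sphere (0 : F) 1, κ σ ∂ν.toSphere) *
          ∫⁻ t : Set.Ioi (0 : ℝ), ENNReal.ofReal (t.1 ^ (-p)) * f t.1
            ∂(.volumeIoiPow (Module.finrank ℝ F - 1)) := by
        refine lintegral_prod_mul (f := fun σ : Metric.sphere (0 : F) 1 => κ σ)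
          (g := fun t : Set.Ioi (0 : ℝ) => ENNReal.ofReal (t.1 ^ (-p)) * f t.1) ?_ ?_
        · exact (hκ.comp measurable_subtype_coe).aemeasurable
        · exact (by fun_prop : Measurable _).aemeasurable
    _ = _ := by
        rw [Measure.volumeIoiPow, lintegral_withDensity_eq_lintegral_mul]
        · congr 1
          exact lintegral_subtype_comap measurableSet_Ioi fun t : ℝ =>
            ENNReal.ofReal (t ^ (Module.finrank ℝ F - 1)) * (ENNReal.ofReal (t ^ (-p)) * f t)
        · fun_prop
        · fun_prop

/-- The weight `1 / (2 |A⁻¹ z|^(n+2s))` of the operator `L_A`. -/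
def kernelLA {n : ℕ} (s : ℝ) (A : Matrix (Fin n) (Fin n) ℝ) (z : E n) : ℝ :=
  1 / 2 / ‖Matrix.toEuclideanLin A⁻¹ z‖ ^ ((n : ℝ) + 2 * s)

theorem integrandLA_eq {n : ℕ} (s : ℝ) (A : Matrix (Fin n) (Fin n) ℝ) (w : E n → ℝ) (x y : E n) :
    integrandLA s A w x y = secondIncr w x y * kernelLA s A y := by
  unfold integrandLA kernelLA
  ring

theorem kernelLA_nonneg {n : ℕ} (s : ℝ) (A : Matrix (Fin n) (Fin n) ℝ) (z : E n) :
    0 ≤ kernelLA s A z := by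
  unfold kernelLA
  positivity

theorem measurable_kernelLA {n : ℕ} (s : ℝ) (A : Matrix (Fin n) (Fin n) ℝ) :
    Measurable (kernelLA s A) := by
  have h : Measurable fun z : E n => Matrix.toEuclideanLin A⁻¹ z :=
    (LinearMap.continuous_of_finiteDimensional (Matrix.toEuclideanLin A⁻¹)).measurable
  unfold kernelLA
  fun_prop

theorem kernelLA_smul {n : ℕ} (s : ℝ) (A : Matrix (Fin n) (Fin n) ℝ) {t : ℝ} (ht : 0 < t)
    (z : E n) : kernelLA s A (t • z) = t ^ (-((n : ℝ) + 2 * s)) * kernelLA s A z := by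
  unfold kernelLA
  rw [map_smul, norm_smul, Real.norm_of_nonneg ht.le, Real.mul_rpow ht.le (norm_nonneg _),
    Real.rpow_neg ht.le, div_mul_eq_div_div, div_right_comm, div_eq_inv_mul]

theorem toEuclideanLin_inv_ne_zero {n : ℕ} {A : Matrix (Fin n) (Fin n) ℝ} (hA : A.det = 1)
    {z : E n} (hz : z ≠ 0) : Matrix.toEuclideanLin A⁻¹ z ≠ 0 := by
  intro h
  have h1 : A⁻¹.mulVec z.ofLp = 0 := by
    have := congrArg WithLp.ofLp h
    simpa [Matrix.ofLp_toLpLin] using this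
  have h2 : A.mulVec (A⁻¹.mulVec z.ofLp) = z.ofLp := by
    rw [Matrix.mulVec_mulVec, Matrix.mul_nonsing_inv A (by simp [hA]), Matrix.one_mulVec]
  rw [h1, Matrix.mulVec_zero] at h2
  exact hz (by ext i; simp [← h2])

/-- The kernel is continuous on the compact sphere, as `A⁻¹` kills no unit vector. The bound depends
on `A`, but only its finiteness is needed. -/
theorem lintegral_sphere_kernelLA_ne_top {n : ℕ} (s : ℝ) {A : Matrix (Fin n) (Fin n) ℝ}
    (hA : A.det = 1) : ∫⁻ σ : Metric.sphere (0 : E n) 1, ENNReal.ofReal (kernelLA s A σ)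
      ∂(volume : Measure (E n)).toSphere ≠ ∞ := by
  have hc : Continuous fun z : E n => Matrix.toEuclideanLin A⁻¹ z :=
    LinearMap.continuous_of_finiteDimensional (Matrix.toEuclideanLin A⁻¹)
  have h0 : ∀ σ : Metric.sphere (0 : E n) 1, Matrix.toEuclideanLin A⁻¹ σ.1 ≠ 0 := fun σ =>
    toEuclideanLin_inv_ne_zero hA (by
      have := σ.2
      rintro h
      simp [h] at this)
  have hk : Continuous fun σ : Metric.sphere (0 : E n) 1 => kernelLA s A σ := by
    unfold kernelLA
    refine continuous_const.div ?_ fun σ => ?_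
    · exact ((hc.comp continuous_subtype_val).norm).rpow_const fun σ =>
        Or.inl (norm_ne_zero_iff.2 (h0 σ))
    · exact (Real.rpow_pos_of_pos (norm_pos_iff.2 (h0 σ)) _).ne'
  have hi : Integrable (fun σ : Metric.sphere (0 : E n) 1 => kernelLA s A σ)
      (volume : Measure (E n)).toSphere :=
    hk.integrable_of_hasCompactSupport (HasCompactSupport.of_compactSpace _)
  exact (hi.lintegral_lt_top).ne

/-- Radial functions are compared in the integrals of `L_A`, uniformly in `A`, through the
one-dimensional weight `t^(-1-2s)`. -/
theorem lintegral_radial_mul_kernelLA_le {n : ℕ} {s : ℝ} {A : Matrix (Fin n) (Fin n) ℝ}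
    (hA : A.det = 1) {e k : ℝ → ℝ≥0∞} (he : Measurable e) (hk : Measurable k) (he0 : e 0 = 0)
    (hek : ∫⁻ t in Set.Ioi (0 : ℝ), ENNReal.ofReal (t ^ (-1 - 2 * s)) * e t ≤
      ∫⁻ t in Set.Ioi (0 : ℝ), ENNReal.ofReal (t ^ (-1 - 2 * s)) * k t)
    (hfin : ∫⁻ t in Set.Ioi (0 : ℝ), ENNReal.ofReal (t ^ (-1 - 2 * s)) * e t ≠ ∞) :
    ∫⁻ z : E n, e ‖z‖ * ENNReal.ofReal (kernelLA s A z) ≤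
        ∫⁻ z : E n, k ‖z‖ * ENNReal.ofReal (kernelLA s A z) ∧
      ∫⁻ z : E n, e ‖z‖ * ENNReal.ofReal (kernelLA s A z) ≠ ∞ := by
  rcases Nat.eq_zero_or_pos n with rfl | hn
  -- Polar coordinates need a nontrivial space; in dimension zero, `e 0 = 0` settles the claim.
  · have : ∀ z : E 0, e ‖z‖ * ENNReal.ofReal (kernelLA s A z) = 0 := fun z => by
      rw [Subsingleton.elim z 0, norm_zero, he0, zero_mul]
    simp [this]
  · have : NeZero n := ⟨hn.ne'⟩
    have : Nontrivial (E n) := by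
      apply Module.nontrivial_of_finrank_pos (R := ℝ)
      simpa using hn
    have polar : ∀ {f : ℝ → ℝ≥0∞}, Measurable f →
        ∫⁻ z : E n, f ‖z‖ * ENNReal.ofReal (kernelLA s A z) =
        (∫⁻ σ : Metric.sphere (0 : E n) 1, ENNReal.ofReal (kernelLA s A σ)
          ∂(volume : Measure (E n)).toSphere) *
        ∫⁻ t in Set.Ioi (0 : ℝ), ENNReal.ofReal (t ^ (-1 - 2 * s)) * f t := by
      intro f hf
      rw [lintegral_radial_mul_homogeneous (volume : Measure (E n)) ((n : ℝ) + 2 * s)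
        (measurable_kernelLA s A).ennreal_ofReal _ hf]
      · congr 1
        refine setLIntegral_congr_fun measurableSet_Ioi fun t ht => ?_
        have ht' : (0 : ℝ) < t := ht
        rw [← mul_assoc, ← ENNReal.ofReal_mul (by positivity), ← Real.rpow_natCast,
          ← Real.rpow_add ht', finrank_euclideanSpace, Fintype.card_fin, Nat.cast_pred hn]
        congr 3
        ring
      · intro t ht z
        rw [kernelLA_smul s A ht, ENNReal.ofReal_mul (by positivity)]
    rw [polar he, polar hk]
    exact ⟨by gcongr, ENNReal.mul_ne_top (lintegral_sphere_kernelLA_ne_top s hA) hfin⟩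

/-! ### One-dimensional integrals and choice of radii -/

theorem lintegral_inner_radial {s : ℝ} (hs : s < 1) {K r : ℝ} (hK : 0 ≤ K) (hr : 0 < r) :
    ∫⁻ t in Set.Ioi (0 : ℝ), ENNReal.ofReal (t ^ (-1 - 2 * s)) *
      ENNReal.ofReal (if t < r then K * t ^ 2 else 0) =
      ENNReal.ofReal (K * (r ^ (2 - 2 * s) / (2 - 2 * s))) := by
  have h1 : ∀ t ∈ Set.Ioi (0 : ℝ), ENNReal.ofReal (t ^ (-1 - 2 * s)) *
      ENNReal.ofReal (if t < r then K * t ^ 2 else 0) =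
      (Set.Iio r).indicator (fun t => ENNReal.ofReal (K * t ^ (1 - 2 * s))) t := by
    intro t ht
    have ht' : (0 : ℝ) < t := ht
    by_cases htr : t < r
    · rw [Set.indicator_of_mem (by exact htr), if_pos htr, ← ENNReal.ofReal_mul (by positivity)]
      congr 1
      rw [mul_left_comm, ← Real.rpow_natCast t 2, ← Real.rpow_add ht']
      congr 2
      push_cast
      ring
    · rw [Set.indicator_of_notMem (by exact htr), if_neg htr]
      simp
  rw [setLIntegral_congr_fun measurableSet_Ioi h1, setLIntegral_indicator measurableSet_Iio,
    Set.inter_comm, Set.Ioi_inter_Iio, restrict_Ioo_eq_restrict_Ioc]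
  have hintg : IntervalIntegrable (fun t : ℝ => K * t ^ (1 - 2 * s)) volume 0 r :=
    (intervalIntegral.intervalIntegrable_rpow' (by linarith)).const_mul K
  rw [← ofReal_integral_eq_lintegral_ofReal hintg.1]
  · rw [← intervalIntegral.integral_of_le hr.le, intervalIntegral.integral_const_mul,
      integral_rpow (Or.inl (by linarith)), show (1 : ℝ) - 2 * s + 1 = 2 - 2 * s by ring,
      Real.zero_rpow (by linarith), sub_zero]
  · filter_upwards [ae_restrict_mem measurableSet_Ioc] with t ht
    have := ht.1
    simp only [Pi.zero_apply]
    positivity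

/-- This is where `1/2 < s` enters: linear growth is integrable at infinity against `t^(-1-2s)`. -/
theorem lintegral_outer_radial {s : ℝ} (hs : 1 / 2 < s) {C ρ : ℝ} (hC : 0 ≤ C) (hρ : 0 < ρ) :
    ∫⁻ t in Set.Ioi (0 : ℝ), ENNReal.ofReal (t ^ (-1 - 2 * s)) *
      ENNReal.ofReal (if ρ < t then C * t else 0) =
      ENNReal.ofReal (C * (ρ ^ (1 - 2 * s) / (2 * s - 1))) := by
  have h1 : ∀ t ∈ Set.Ioi (0 : ℝ), ENNReal.ofReal (t ^ (-1 - 2 * s)) *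
      ENNReal.ofReal (if ρ < t then C * t else 0) =
      (Set.Ioi ρ).indicator (fun t => ENNReal.ofReal (C * t ^ (-2 * s))) t := by
    intro t ht
    have ht' : (0 : ℝ) < t := ht
    by_cases htr : ρ < t
    · rw [Set.indicator_of_mem (by exact htr), if_pos htr, ← ENNReal.ofReal_mul (by positivity)]
      congr 1
      nth_rewrite 2 [← Real.rpow_one t]
      rw [mul_left_comm, ← Real.rpow_add ht']
      congr 2
      ring
    · rw [Set.indicator_of_notMem (by exact htr), if_neg htr]
      simp
  rw [setLIntegral_congr_fun measurableSet_Ioi h1, setLIntegral_indicator measurableSet_Ioi,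
    Set.inter_eq_self_of_subset_left (Set.Ioi_subset_Ioi hρ.le)]
  have hintg : IntegrableOn (fun t : ℝ => C * t ^ (-2 * s)) (Set.Ioi ρ) :=
    (integrableOn_Ioi_rpow_of_lt (by linarith) hρ).const_mul C
  rw [← ofReal_integral_eq_lintegral_ofReal hintg]
  · rw [integral_const_mul, integral_Ioi_rpow_of_lt (by linarith) hρ,
      show (-2 : ℝ) * s + 1 = 1 - 2 * s by ring, neg_div, ← div_neg, neg_sub]
  · filter_upwards [ae_restrict_mem measurableSet_Ioi] with t ht
    have : 0 < t := hρ.trans ht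
    simp only [Pi.zero_apply]
    positivity

/-- The error profile: quadratic near the origin, linear at infinity. -/
def errorProfile (K r C ρ t : ℝ) : ℝ :=
  (if t < r then K * t ^ 2 else 0) + (if ρ < t then C * t else 0)

/-- The gain profile: a truncated quadratic. -/
def gainProfile (c R t : ℝ) : ℝ := if t < R then c * t ^ 2 else 0

theorem measurable_errorProfile (K r C ρ : ℝ) : Measurable (errorProfile K r C ρ) := by
  unfold errorProfile
  refine Measurable.add ?_ ?_
  · exact Measurable.ite measurableSet_Iio (by fun_prop) (by fun_prop)
  · exact Measurable.ite measurableSet_Ioi (by fun_prop) (by fun_prop)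

theorem measurable_gainProfile (c R : ℝ) : Measurable (gainProfile c R) :=
  Measurable.ite measurableSet_Iio (by fun_prop) (by fun_prop)

/-- The gain dominates the error if `ρ` is large, and then `r` small. -/
theorem exists_radii {s : ℝ} (hs₁ : 1 / 2 < s) (hs₂ : s < 1) {c R C : ℝ} (hc : 0 < c)
    (hR : 0 < R) (hC : 0 ≤ C) (ρ₀ : ℝ) :
    ∃ ρ : ℝ, ρ₀ ≤ ρ ∧ 0 < ρ ∧ ∀ K : ℝ, 0 ≤ K → ∀ r₀ : ℝ, 0 < r₀ → ∃ r : ℝ, 0 < r ∧ r ≤ r₀ ∧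
      ∫⁻ t in Set.Ioi (0 : ℝ), ENNReal.ofReal (t ^ (-1 - 2 * s)) *
          ENNReal.ofReal (errorProfile K r C ρ t) ≤
        ∫⁻ t in Set.Ioi (0 : ℝ), ENNReal.ofReal (t ^ (-1 - 2 * s)) *
          ENNReal.ofReal (gainProfile c R t) ∧
      ∫⁻ t in Set.Ioi (0 : ℝ), ENNReal.ofReal (t ^ (-1 - 2 * s)) *
          ENNReal.ofReal (errorProfile K r C ρ t) ≠ ∞ := by
  have hG : 0 < c * (R ^ (2 - 2 * s) / (2 - 2 * s)) := by
    have : 0 < 2 - 2 * s := by linarith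
    positivity
  set G := c * (R ^ (2 - 2 * s) / (2 - 2 * s)) with hGdef
  have lim1 : Tendsto (fun ρ : ℝ => C * (ρ ^ (1 - 2 * s) / (2 * s - 1))) atTop (𝓝 0) := by
    have := ((tendsto_rpow_neg_atTop (y := 2 * s - 1) (by linarith)).div_const
      (2 * s - 1)).const_mul C
    simpa [neg_sub] using this
  -- Half of the gain `G` pays for the tail, before `K` is known; the other half is kept for the
  -- inner error.
  obtain ⟨ρ, hρ⟩ := ((lim1.eventually_lt_const (half_pos hG)).and
    ((eventually_ge_atTop ρ₀).and (eventually_gt_atTop 0))).exists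
  refine ⟨ρ, hρ.2.1, hρ.2.2, fun K hK r₀ hr₀ => ?_⟩
  have lim2 : Tendsto (fun r : ℝ => K * (r ^ (2 - 2 * s) / (2 - 2 * s))) (𝓝[>] 0) (𝓝 0) := by
    have h0 : ContinuousAt (fun r : ℝ => K * (r ^ (2 - 2 * s) / (2 - 2 * s))) 0 :=
      ((Real.continuousAt_rpow_const _ _ (Or.inr (by linarith))).div_const _).const_mul K
    have := h0.tendsto
    simp only [Real.zero_rpow (show 2 - 2 * s ≠ 0 by linarith), zero_div, mul_zero] at this
    exact this.mono_left nhdsWithin_le_nhds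
  obtain ⟨r, hr⟩ := ((lim2.eventually_lt_const (half_pos hG)).and
    (Ioc_mem_nhdsGT hr₀)).exists
  have hsum : ∫⁻ t in Set.Ioi (0 : ℝ), ENNReal.ofReal (t ^ (-1 - 2 * s)) *
          ENNReal.ofReal (errorProfile K r C ρ t) =
      ENNReal.ofReal (K * (r ^ (2 - 2 * s) / (2 - 2 * s))) +
        ENNReal.ofReal (C * (ρ ^ (1 - 2 * s) / (2 * s - 1))) := by
    rw [← lintegral_inner_radial hs₂ hK hr.2.1, ← lintegral_outer_radial hs₁ hC hρ.2.2,
      ← lintegral_add_left]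
    · refine setLIntegral_congr_fun measurableSet_Ioi fun t ht => ?_
      have ht' : (0 : ℝ) < t := ht
      simp only [errorProfile]
      rw [ENNReal.ofReal_add, mul_add]
      · split_ifs <;> positivity
      · split_ifs <;> positivity
    · exact (by fun_prop : Measurable fun t : ℝ => ENNReal.ofReal (t ^ (-1 - 2 * s))).mul
        (Measurable.ite measurableSet_Iio (by fun_prop) (by fun_prop)).ennreal_ofReal
  refine ⟨r, hr.2.1, hr.2.2, ?_, ?_⟩
  · rw [hsum]
    unfold gainProfile
    rw [lintegral_inner_radial hs₂ hc.le hR, ← hGdef,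
      ← add_halves G, ENNReal.ofReal_add (half_pos hG).le (half_pos hG).le]
    gcongr
    · exact hr.1.le
    · exact hρ.1.le
  · rw [hsum]
    simp

/-! ### Comparison of the linear operators -/

theorem measurable_integrandLA {n : ℕ} (s : ℝ) (A : Matrix (Fin n) (Fin n) ℝ) {w : E n → ℝ}
    (hw : Measurable w) (x : E n) : Measurable (integrandLA s A w x) := by
  have h : integrandLA s A w x = fun y => secondIncr w x y * kernelLA s A y :=
    funext fun y => integrandLA_eq s A w x y
  rw [h]
  have := measurable_kernelLA s A
  unfold secondIncr
  fun_prop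

/-- Comparison of `L_A` at two points when the second increments are ordered up to an error whose
integral is dominated by that of a gain. -/
theorem LA_le_LA_of_secondIncr_le {n : ℕ} {s : ℝ} {A : Matrix (Fin n) (Fin n) ℝ}
    {w₁ w₂ : E n → ℝ} (hw₁ : Measurable w₁) (hw₂ : Measurable w₂) {x y : E n} {e k : ℝ → ℝ}
    (he : Measurable e) (hk : Measurable k) (he0 : ∀ t, 0 ≤ t → 0 ≤ e t)
    (hk0 : ∀ t, 0 ≤ t → 0 ≤ k t)
    (h : ∀ z, secondIncr w₁ x z + k ‖z‖ ≤ secondIncr w₂ y z + e ‖z‖)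
    (hek : ∫⁻ z : E n, ENNReal.ofReal (e ‖z‖) * ENNReal.ofReal (kernelLA s A z) ≤
        ∫⁻ z : E n, ENNReal.ofReal (k ‖z‖) * ENNReal.ofReal (kernelLA s A z))
    (hfin : ∫⁻ z : E n, ENNReal.ofReal (e ‖z‖) * ENNReal.ofReal (kernelLA s A z) ≠ ∞)
    (hN : negIntegral s A w₁ x ≠ ∞)
    (hdef : posIntegral s A w₂ y ≠ ∞ ∨ negIntegral s A w₂ y ≠ ∞) :
    LA s A w₁ x ≤ LA s A w₂ y := by
  have hm₁ := measurable_integrandLA s A hw₁ x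
  have hm₂ := measurable_integrandLA s A hw₂ y
  have hκ := measurable_kernelLA s A
  -- Negative parts are moved across so that only sums of nonnegative terms get integrated and no `∞
  -- - ∞` can arise.
  have hpt : ∀ z : E n, ENNReal.ofReal (integrandLA s A w₁ x z) +
      ENNReal.ofReal (-integrandLA s A w₂ y z) +
        ENNReal.ofReal (k ‖z‖) * ENNReal.ofReal (kernelLA s A z) ≤
      ENNReal.ofReal (integrandLA s A w₂ y z) + ENNReal.ofReal (-integrandLA s A w₁ x z) +
        ENNReal.ofReal (e ‖z‖) * ENNReal.ofReal (kernelLA s A z) := by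
    intro z
    have omax : ∀ a : ℝ, ENNReal.ofReal a = ENNReal.ofReal (max a 0) := fun a => by
      rcases le_total a 0 with ha | ha
      · rw [max_eq_right ha, ENNReal.ofReal_of_nonpos ha, ENNReal.ofReal_zero]
      · rw [max_eq_left ha]
    have hκ0 := kernelLA_nonneg s A z
    have hz := mul_le_mul_of_nonneg_right (h z) hκ0
    rw [← ENNReal.ofReal_mul (hk0 _ (norm_nonneg z)), ← ENNReal.ofReal_mul (he0 _ (norm_nonneg z)),
      omax (integrandLA s A w₁ x z),
      omax (integrandLA s A w₂ y z),
      omax (-integrandLA s A w₁ x z),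
      omax (-integrandLA s A w₂ y z)]
    have hkz := mul_nonneg (hk0 _ (norm_nonneg z)) hκ0
    have hez := mul_nonneg (he0 _ (norm_nonneg z)) hκ0
    rw [← ENNReal.ofReal_add (by positivity) (by positivity),
      ← ENNReal.ofReal_add (by positivity) (by positivity),
      ← ENNReal.ofReal_add (by positivity) (by positivity),
      ← ENNReal.ofReal_add (by positivity) (by positivity)]
    apply ENNReal.ofReal_le_ofReal
    have aux : ∀ a : ℝ, max a 0 = a + max (-a) 0 := fun a => by
      rcases le_total a 0 with ha | ha
      · rw [max_eq_right ha, max_eq_left (by linarith)]; ring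
      · rw [max_eq_left ha, max_eq_right (by linarith)]; ring
    rw [aux (integrandLA s A w₁ x z), aux (integrandLA s A w₂ y z), integrandLA_eq, integrandLA_eq]
    linarith
  have hintg := lintegral_mono (μ := volume) hpt
  rw [lintegral_add_left (by fun_prop), lintegral_add_left (by fun_prop),
    lintegral_add_left (by fun_prop), lintegral_add_left (by fun_prop)] at hintg
  have hsum : posIntegral s A w₁ x + negIntegral s A w₂ y ≤
      posIntegral s A w₂ y + negIntegral s A w₁ x := by
    rw [← ENNReal.add_le_add_iff_right hfin]
    exact (add_le_add_right hek _).trans hintg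
  unfold LA
  generalize posIntegral s A w₁ x = P₁ at *
  generalize negIntegral s A w₁ x = N₁ at *
  generalize posIntegral s A w₂ y = P₂ at *
  generalize negIntegral s A w₂ y = N₂ at *
  by_cases hP : P₂ = ∞
  · have hN₂ : N₂ ≠ ∞ := hdef.resolve_left (not_not.2 hP)
    lift N₂ to ℝ≥0 using hN₂
    have : ((∞ : ℝ≥0∞) : EReal) - (((N₂ : ℝ≥0) : ℝ≥0∞) : EReal) = ⊤ := by
      exact EReal.top_sub_coe (N₂ : ℝ)
    rw [hP, this]
    exact le_top
  · have hlt : P₁ + N₂ ≠ ∞ := ne_top_of_le_ne_top (ENNReal.add_ne_top.2 ⟨hP, hN⟩) hsum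
    obtain ⟨hP₁, hN₂⟩ := ENNReal.add_ne_top.1 hlt
    lift P₁ to ℝ≥0 using hP₁
    lift N₁ to ℝ≥0 using hN
    lift P₂ to ℝ≥0 using hP
    lift N₂ to ℝ≥0 using hN₂
    have hreal : (P₁ : ℝ) + N₂ ≤ P₂ + N₁ := by exact_mod_cast hsum
    have : ((P₁ : ℝ) - (N₁ : ℝ) : ℝ) ≤ ((P₂ : ℝ) - (N₂ : ℝ) : ℝ) := by linarith
    have hE := EReal.coe_le_coe_iff.2 this
    rw [EReal.coe_sub, EReal.coe_sub] at hE
    exact hE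

theorem negIntegral_ne_top_of_coe_le_LA {n : ℕ} {s : ℝ} {A : Matrix (Fin n) (Fin n) ℝ}
    {w : E n → ℝ} {x : E n} {a : ℝ} (h : (a : EReal) ≤ LA s A w x) : negIntegral s A w x ≠ ∞ := by
  intro hN
  have : LA s A w x = ⊥ := by
    unfold LA
    rw [hN]
    exact EReal.sub_top _
  rw [this] at h
  exact EReal.coe_ne_bot a (le_bot_iff.1 h)

/-! ### Glued test functions and the quadratic perturbation -/

theorem glue_apply_of_mem {n : ℕ} {N : Set (E n)} {ψ u : E n → ℝ} {y : E n} (h : y ∈ N) :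
    glue N ψ u y = ψ y := by
  simp [glue, h]

theorem glue_apply_of_notMem {n : ℕ} {N : Set (E n)} {ψ u : E n → ℝ} {y : E n} (h : y ∉ N) :
    glue N ψ u y = u y := by
  simp [glue, h]

theorem measurable_glue {n : ℕ} {N : Set (E n)} (hN : MeasurableSet N) {ψ u : E n → ℝ}
    (hψ : Measurable ψ) (hu : Measurable u) : Measurable (glue N ψ u) := by
  classical
  have : glue N ψ u = N.piecewise ψ u := by
    ext y
    simp [glue, Set.piecewise]
  rw [this]
  exact hψ.piecewise hN hu

theorem secondIncr_glue_ball_of_lt {n : ℕ} {ψ u : E n → ℝ} {x z : E n} {r : ℝ} (hz : ‖z‖ < r) :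
    secondIncr (glue (Metric.ball x r) ψ u) x z = secondIncr ψ x z := by
  have hr : 0 < r := (norm_nonneg z).trans_lt hz
  unfold secondIncr
  rw [glue_apply_of_mem (by simpa [mem_ball_iff_norm] using hz),
    glue_apply_of_mem (by simpa [mem_ball_iff_norm] using hz),
    glue_apply_of_mem (Metric.mem_ball_self hr)]

theorem secondIncr_glue_ball_of_le {n : ℕ} {ψ u : E n → ℝ} {x z : E n} {r : ℝ} (hr : 0 < r)
    (hψ : ψ x = u x) (hz : r ≤ ‖z‖) :
    secondIncr (glue (Metric.ball x r) ψ u) x z = secondIncr u x z := by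
  unfold secondIncr
  rw [glue_apply_of_notMem (by simpa [mem_ball_iff_norm] using hz),
    glue_apply_of_notMem (by simpa [mem_ball_iff_norm] using hz),
    glue_apply_of_mem (Metric.mem_ball_self hr), hψ]

theorem secondIncr_norm_sub_sq {n : ℕ} (y x z : E n) :
    ‖x + z - y‖ ^ 2 + ‖x - z - y‖ ^ 2 - 2 * ‖x - y‖ ^ 2 = 2 * ‖z‖ ^ 2 := by
  have := parallelogram_law_with_norm ℝ (x - y) z
  rw [show x + z - y = x - y + z by abel, show x - z - y = x - y - z by abel]
  linarith

/-- A bounded function equal to `|x|²` in a ball. -/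
def truncSq {n : ℕ} (R : ℝ) (x : E n) : ℝ := min (‖x‖ ^ 2) (4 * R ^ 2)

theorem truncSq_eq {n : ℕ} {R : ℝ} {x : E n} (h : ‖x‖ ≤ 2 * R) : truncSq R x = ‖x‖ ^ 2 := by
  refine min_eq_left ?_
  nlinarith [norm_nonneg x]

theorem truncSq_nonneg {n : ℕ} (R : ℝ) (x : E n) : 0 ≤ truncSq R x := by
  unfold truncSq
  positivity

theorem truncSq_le {n : ℕ} (R : ℝ) (x : E n) : truncSq R x ≤ 4 * R ^ 2 := min_le_right _ _

theorem continuous_truncSq {n : ℕ} (R : ℝ) : Continuous (truncSq R : E n → ℝ) := by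
  unfold truncSq
  fun_prop

/-- While `x ± z` stay in the ball of radius `2R` this is the parallelogram law. If one of them
leaves it, the value `4R²` there already exceeds `2|x|² ≤ 2R²`. -/
theorem gainProfile_le_secondIncr_truncSq {n : ℕ} {R : ℝ} {x : E n} (hx : ‖x‖ ≤ R) (z : E n) :
    gainProfile 2 R ‖z‖ ≤ secondIncr (truncSq R) x z := by
  have hR : 0 ≤ R := (norm_nonneg x).trans hx
  have hsq := secondIncr_norm_sub_sq 0 x z
  simp only [sub_zero] at hsq
  have hx' : truncSq R x = ‖x‖ ^ 2 := truncSq_eq (by linarith)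
  have h1 := norm_add_le x z
  have h2 := norm_sub_le x z
  unfold gainProfile secondIncr
  rw [hx']
  split_ifs with hz
  · rw [truncSq_eq (by linarith), truncSq_eq (by linarith)]
    linarith
  · by_cases hp : ‖x + z‖ ≤ 2 * R ∧ ‖x - z‖ ≤ 2 * R
    · rw [truncSq_eq hp.1, truncSq_eq hp.2]
      nlinarith [sq_nonneg ‖z‖]
    · have hxR : ‖x‖ ^ 2 ≤ R ^ 2 := by gcongr
      have h3 := truncSq_nonneg R (x + z)
      have h4 := truncSq_nonneg R (x - z)
      have big : ∀ q : E n, 2 * R < ‖q‖ → truncSq R q = 4 * R ^ 2 := fun q hq =>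
        min_eq_right (by nlinarith)
      rcases not_and_or.1 hp with h | h
      · rw [big _ (not_le.1 h)]
        nlinarith
      · rw [big _ (not_le.1 h)]
        nlinarith

/-! ### Viscosity inequalities at a doubled maximum -/

/-- At a maximum point of the doubled function over a large ball, the two right-hand sides are
ordered. The radius is uniform in the penalization parameter. -/
theorem exists_radius_rhs_le_of_doubled_max {n : ℕ} {s : ℝ} (hs₁ : 1 / 2 < s) (hs₂ : s < 1)
    {fu fv u v : E n → ℝ} (hu : IsViscositySubsolution s fu u)
    (hv : IsViscositySupersolution s fv v) {C R θ : ℝ} (hC : 0 ≤ C) (hR : 0 < R) (hθ : 0 < θ)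
    (hu_le : ∀ z, u z ≤ C * (1 + ‖z‖)) (hv_ge : ∀ z, -(C * (1 + ‖z‖)) ≤ v z) :
    ∃ ρ : ℝ, R ≤ ρ ∧ ∀ (β : ℝ) (x y : E n), 0 ≤ β → ‖x‖ < R → ‖y‖ < R → v y ≤ u x →
      (∀ a b : E n, ‖a‖ ≤ ρ → ‖b‖ ≤ ρ →
        u a + θ * truncSq R a - v b - β * ‖a - b‖ ^ 2 ≤
          u x + θ * truncSq R x - v y - β * ‖x - y‖ ^ 2) →
      fu x ≤ fv y := by
  -- Four values of `u` and `v`, each at most `C(2+R)|z|` in the tail, give the constant; `ρ ≥ R +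
  -- 1` makes `|z| ≥ 1` there.
  obtain ⟨ρ, hρ₀, hρ, hrad⟩ := exists_radii hs₁ hs₂ (c := 2 * θ) (R := R) (C := 4 * C * (2 + R))
    (by positivity) hR (by positivity) (R + 1)
  -- The extra `R` keeps `x ± z` and `y ± z` in the ball whenever `|z| ≤ ρ`.
  refine ⟨ρ + R, by linarith, fun β x y hβ hx hy hyx hmax => ?_⟩
  obtain ⟨r, hr, hrR, hek, hfin⟩ := hrad (4 * β + 4) (by positivity) R hR
  -- Freezing one variable in the maximality inequality yields the test functions; the last square
  -- makes the contact strict.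
  set ψ₁ : E n → ℝ := fun a => u x + θ * (‖x‖ ^ 2 - ‖a - 0‖ ^ 2) +
    β * (‖a - y‖ ^ 2 - ‖x - y‖ ^ 2) + ‖a - x‖ ^ 2 with hψ₁
  set ψ₂ : E n → ℝ := fun b => v y - β * (‖b - x‖ ^ 2 - ‖y - x‖ ^ 2) - ‖b - y‖ ^ 2 with hψ₂
  have hcd₁ : ContDiff ℝ 2 ψ₁ := by
    have : ∀ c : E n, ContDiff ℝ 2 fun a : E n => ‖a - c‖ ^ 2 := fun c =>
      (contDiff_id.sub contDiff_const).norm_sq ℝ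
    have h0 := this 0
    have h1 := this y
    have h2 := this x
    fun_prop
  have hcd₂ : ContDiff ℝ 2 ψ₂ := by
    have : ∀ c : E n, ContDiff ℝ 2 fun a : E n => ‖a - c‖ ^ 2 := fun c =>
      (contDiff_id.sub contDiff_const).norm_sq ℝ
    have h1 := this y
    have h2 := this x
    fun_prop
  have hx₁ : ψ₁ x = u x := by simp [hψ₁]
  have hy₂ : ψ₂ y = v y := by simp [hψ₂]
  have hball : ∀ {c a : E n}, ‖c‖ < R → a ∈ Metric.ball c r → ‖a‖ ≤ 2 * R := by
    intro c a hc ha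
    rw [mem_ball_iff_norm] at ha
    have := norm_add_le (a - c) c
    rw [sub_add_cancel] at this
    linarith
  have htouch₁ : ∀ a ∈ Metric.ball x r \ {x}, u a < ψ₁ a := by
    rintro a ⟨ha, hax⟩
    have hpos : 0 < ‖a - x‖ := norm_pos_iff.2 (sub_ne_zero.2 hax)
    have h2R := hball hx ha
    have h := hmax a y (by linarith) (by linarith)
    rw [truncSq_eq h2R, truncSq_eq (by linarith)] at h
    simp only [hψ₁, sub_zero]
    nlinarith [sq_pos_of_pos hpos]
  have htouch₂ : ∀ b ∈ Metric.ball y r \ {y}, ψ₂ b < v b := by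
    rintro b ⟨hb, hby⟩
    have hpos : 0 < ‖b - y‖ := norm_pos_iff.2 (sub_ne_zero.2 hby)
    have h2R := hball hy hb
    have h := hmax x b (by linarith) (by linarith)
    rw [norm_sub_rev x b, norm_sub_rev x y] at h
    simp only [hψ₂]
    nlinarith [sq_pos_of_pos hpos]
  have hsub := hu.2 x (Metric.ball x r) ψ₁ Metric.isOpen_ball (Metric.mem_ball_self hr)
    ⟨Set.univ, isOpen_univ, Set.subset_univ _, hcd₁.contDiffOn⟩ hx₁ htouch₁
  have hsup := hv.2 y (Metric.ball y r) ψ₂ Metric.isOpen_ball (Metric.mem_ball_self hr)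
    ⟨Set.univ, isOpen_univ, Set.subset_univ _, hcd₂.contDiffOn⟩ hy₂ htouch₂
  have hpt : ∀ z, secondIncr (glue (Metric.ball x r) ψ₁ u) x z + gainProfile (2 * θ) R ‖z‖ ≤
      secondIncr (glue (Metric.ball y r) ψ₂ v) y z +
        errorProfile (4 * β + 4) r (4 * C * (2 + R)) ρ ‖z‖ := by
    intro z
    have hz0 := norm_nonneg z
    rcases lt_or_ge ‖z‖ r with hz | hz
    · rw [secondIncr_glue_ball_of_lt hz, secondIncr_glue_ball_of_lt hz]
      have e1 := secondIncr_norm_sub_sq 0 x z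
      have e2 := secondIncr_norm_sub_sq y x z
      have e3 := secondIncr_norm_sub_sq x x z
      have e4 := secondIncr_norm_sub_sq x y z
      have e5 := secondIncr_norm_sub_sq y y z
      have d1 : secondIncr ψ₁ x z = (-(2 * θ) + 2 * β + 2) * ‖z‖ ^ 2 := by
        simp only [secondIncr, hψ₁]
        simp only [sub_self, norm_zero] at e3 ⊢
        rw [sub_zero x] at e1 ⊢
        linear_combination (-θ) * e1 + β * e2 + e3
      have d2 : secondIncr ψ₂ y z = -(2 * β + 2) * ‖z‖ ^ 2 := by
        simp only [secondIncr, hψ₂]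
        simp only [sub_self, norm_zero] at e5 ⊢
        linear_combination (-β) * e4 - e5
      rw [d1, d2, errorProfile, gainProfile, if_pos hz, if_pos (by linarith),
        if_neg (by linarith)]
      -- The constant `4β + 4` is exactly the gap between `2β + 2` and `-(2β + 2)`; the `θ` terms
      -- cancel.
      apply le_of_eq
      ring
    · rw [secondIncr_glue_ball_of_le hr hx₁ hz, secondIncr_glue_ball_of_le hr hy₂ hz, errorProfile,
        if_neg (not_lt.2 hz), zero_add]
      have n1 := norm_add_le x z
      have n2 := norm_sub_le x z
      have n3 := norm_add_le y z
      have n4 := norm_sub_le y z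
      rcases le_or_gt ‖z‖ ρ with hzρ | hzρ
      · rw [if_neg (not_lt.2 hzρ)]
        have m1 := hmax (x + z) (y + z) (by linarith) (by linarith)
        have m2 := hmax (x - z) (y - z) (by linarith) (by linarith)
        rw [add_sub_add_right_eq_sub] at m1
        rw [sub_sub_sub_cancel_right] at m2
        have hg := mul_le_mul_of_nonneg_left (gainProfile_le_secondIncr_truncSq hx.le z) hθ.le
        have hgain : θ * gainProfile 2 R ‖z‖ = gainProfile (2 * θ) R ‖z‖ := by
          unfold gainProfile
          split_ifs <;> ring
        rw [hgain] at hg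
        simp only [secondIncr] at hg ⊢
        linarith
      · rw [if_pos hzρ, gainProfile, if_neg (by linarith)]
        simp only [secondIncr]
        have b1 := hu_le (x + z)
        have b2 := hu_le (x - z)
        have b3 := hv_ge (y + z)
        have b4 := hv_ge (y - z)
        have c : ∀ {q : E n}, ‖q‖ ≤ R + ‖z‖ → C * (1 + ‖q‖) ≤ C * ((2 + R) * ‖z‖) := by
          intro q hq
          refine mul_le_mul_of_nonneg_left ?_ hC
          nlinarith
        have c1 := c (q := x + z) (by linarith)
        have c2 := c (q := x - z) (by linarith)
        have c3 := c (q := y + z) (by linarith)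
        have c4 := c (q := y - z) (by linarith)
        linarith
  have he0 : ∀ t, 0 ≤ t → 0 ≤ errorProfile (4 * β + 4) r (4 * C * (2 + R)) ρ t := by
    intro t ht
    unfold errorProfile
    split_ifs <;> positivity
  have hk0 : ∀ t, 0 ≤ t → 0 ≤ gainProfile (2 * θ) R t := by
    intro t ht
    unfold gainProfile
    split_ifs <;> positivity
  have hinf : (fu x : EReal) ≤ Ds s (glue (Metric.ball y r) ψ₂ v) y := by
    refine le_iInf fun A => ?_
    have hA₁ : (fu x : EReal) ≤ LA s A.1 (glue (Metric.ball x r) ψ₁ u) x :=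
      hsub.2.trans (iInf_le _ A)
    have hcmp := lintegral_radial_mul_kernelLA_le (n := n) (s := s) A.2.2
      (measurable_errorProfile (4 * β + 4) r (4 * C * (2 + R)) ρ).ennreal_ofReal
      (measurable_gainProfile (2 * θ) R).ennreal_ofReal
      (by simp [errorProfile]) hek hfin
    exact hA₁.trans (LA_le_LA_of_secondIncr_le
      (measurable_glue measurableSet_ball hcd₁.continuous.measurable hu.1.measurable)
      (measurable_glue measurableSet_ball hcd₂.continuous.measurable hv.1.measurable)
      (measurable_errorProfile _ _ _ _) (measurable_gainProfile _ _) he0 hk0 hpt hcmp.1 hcmp.2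
      (negIntegral_ne_top_of_coe_le_LA hA₁) (hsup.1 A.1 A.2))
  exact EReal.coe_le_coe_iff.1 (hinf.trans hsup.2)

/-! ### Growth bounds -/

/-- Semicontinuity bounds `u` on a compact ball, and outside it `u ≤ φ + 1`. Applied to `-v` and
`-φ`, it also bounds `v` from below. -/
theorem exists_linear_upper_bound {n : ℕ} {u φ : E n → ℝ} (hu : UpperSemicontinuous u)
    (hφ : HasLinearGrowth φ) (hlim : Tendsto (fun x => u x - φ x) (cocompact (E n)) (𝓝 0)) :
    ∃ C : ℝ, 0 ≤ C ∧ ∀ x, u x ≤ C * (1 + ‖x‖) := by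
  obtain ⟨C, hC⟩ := hφ
  obtain ⟨r, hr⟩ := Metric.closedBall_compl_subset_of_mem_cocompact
    (hlim.eventually_le_const (show (0 : ℝ) < 1 by norm_num)) 0
  obtain ⟨B, hB⟩ := (hu.upperSemicontinuousOn (Metric.closedBall 0 r)).bddAbove_of_isCompact
    (isCompact_closedBall 0 r)
  have hC0 : 0 ≤ C := by
    have := (abs_nonneg _).trans (hC 0)
    simpa using this
  refine ⟨max B 0 + (C + 1), by positivity, fun x => ?_⟩
  have hx := norm_nonneg x
  have hB0 := le_max_right B 0
  by_cases hxr : x ∈ Metric.closedBall (0 : E n) r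
  · have := hB (Set.mem_image_of_mem u hxr)
    nlinarith [le_max_left B 0]
  · have h1 : u x - φ x ≤ 1 := hr hxr
    have h2 := (le_abs_self _).trans (hC x)
    nlinarith

theorem HasLinearGrowth.neg {n : ℕ} {φ : E n → ℝ} (h : HasLinearGrowth φ) :
    HasLinearGrowth (-φ) := by
  obtain ⟨C, hC⟩ := h
  exact ⟨C, fun x => by simpa using hC x⟩

end FracMA

end

/-! ### The comparison principle -/

theorem theorem4p1 (n : ℕ) (s : ℝ) (hs₁ : 1 / 2 < s) (hs₂ : s < 1)
    (g : FracMA.E n → ℝ → ℝ) (hg : Continuous fun p : FracMA.E n × ℝ => g p.1 p.2)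
    (μ : ℝ) (hμ : 0 < μ)
    (hmono : ∀ (x : FracMA.E n) (t₁ t₂ : ℝ), t₂ ≤ t₁ → μ * (t₁ - t₂) ≤ g x t₁ - g x t₂)
    (α : ℝ≥0) (hα₀ : 0 < α) (hα₁ : α ≤ 1)
    (φ : FracMA.E n → ℝ) (hφ : FracMA.IsC2Alpha α φ) (hφ_growth : FracMA.HasLinearGrowth φ)
    (u v : FracMA.E n → ℝ)
    (hu : FracMA.IsViscositySubsolution s (fun x => g x (u x)) u)
    (hu_lim : Tendsto (fun x => u x - φ x) (cocompact (FracMA.E n)) (𝓝 0))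
    (hv : FracMA.IsViscositySupersolution s (fun x => g x (v x)) v)
    (hv_lim : Tendsto (fun x => v x - φ x) (cocompact (FracMA.E n)) (𝓝 0)) :
    ∀ x, u x ≤ v x := by
  intro x₀
  by_contra! hx₀
  have hnegv : UpperSemicontinuous (-v) := hv.1.neg
  obtain ⟨C₁, hC₁, hu_le⟩ := FracMA.exists_linear_upper_bound hu.1 hφ_growth hu_lim
  obtain ⟨C₂, hC₂, hv_ge⟩ := FracMA.exists_linear_upper_bound hnegv hφ_growth.neg (by
    have := hv_lim.neg
    rw [neg_zero] at this
    refine this.congr fun x => ?_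
    simp only [Pi.neg_apply]
    ring)
  set C := C₁ + C₂ with hCdef
  have hC : 0 ≤ C := by positivity
  replace hu_le : ∀ z, u z ≤ C * (1 + ‖z‖) := fun z => (hu_le z).trans (by gcongr; linarith)
  replace hv_ge : ∀ z, -(C * (1 + ‖z‖)) ≤ v z := fun z => by
    have h1 := hv_ge z
    have h2 : C₂ * (1 + ‖z‖) ≤ C * (1 + ‖z‖) := by gcongr; linarith
    simp only [Pi.neg_apply] at h1
    linarith
  set m := u x₀ - v x₀ with hm
  have hm0 : 0 < m := sub_pos.2 hx₀
  have huv : Tendsto (fun x => u x - v x) (cocompact (FracMA.E n)) (𝓝 0) := by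
    have := hu_lim.sub hv_lim
    rw [sub_zero] at this
    exact this.congr fun x => by ring
  obtain ⟨R₀, hR₀⟩ := Metric.closedBall_compl_subset_of_mem_cocompact
    (huv.eventually_le_const (show (0 : ℝ) < m / 4 by positivity)) 0
  set R := max R₀ 0 + 1 with hRdef
  have hR : 0 < R := by positivity
  have hfar : ∀ x, R ≤ ‖x‖ → u x - v x ≤ m / 4 := fun x hx => by
    refine hR₀ ?_
    simp only [Set.mem_compl_iff, mem_closedBall_zero_iff, not_le]
    linarith [le_max_left R₀ 0]
  have hx₀R : ‖x₀‖ < R := by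
    by_contra! h
    linarith [hfar x₀ h]
  -- Chosen so that the perturbation never exceeds `m/4`.
  set θ := m / (16 * R ^ 2) with hθdef
  have hθ : 0 < θ := by positivity
  have hθR : θ * (4 * R ^ 2) = m / 4 := by
    rw [hθdef]
    field_simp
    norm_num
  obtain ⟨ρ, hRρ, hρ⟩ := FracMA.exists_radius_rhs_le_of_doubled_max hs₁ hs₂ hu hv hC hR hθ
    hu_le hv_ge
  have hθh : ∀ a : FracMA.E n, 0 ≤ θ * FracMA.truncSq R a ∧ θ * FracMA.truncSq R a ≤ m / 4 :=
    fun a => ⟨mul_nonneg hθ.le (FracMA.truncSq_nonneg R a), by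
      rw [← hθR]
      exact mul_le_mul_of_nonneg_left (FracMA.truncSq_le R a) hθ.le⟩
  set F : FracMA.E n × FracMA.E n → ℝ := fun p => u p.1 + θ * FracMA.truncSq R p.1 - v p.2
    with hF
  have hFusc : UpperSemicontinuous F := by
    have h1 : UpperSemicontinuous fun p : FracMA.E n × FracMA.E n => u p.1 :=
      hu.1.comp continuous_fst
    have h2 : UpperSemicontinuous fun p : FracMA.E n × FracMA.E n => (-v) p.2 :=
      hnegv.comp continuous_snd
    have h3 : UpperSemicontinuous fun p : FracMA.E n × FracMA.E n => θ * FracMA.truncSq R p.1 :=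
      (((FracMA.continuous_truncSq R).comp continuous_fst).const_mul θ).upperSemicontinuous
    have h4 := (h1.add h3).add h2
    have h5 : F = fun p => u p.1 + θ * FracMA.truncSq R p.1 + (-v) p.2 := by
      ext p
      simp [hF, sub_eq_add_neg]
    rw [h5]
    exact h4
  set K : Set (FracMA.E n × FracMA.E n) :=
    Metric.closedBall 0 ρ ×ˢ Metric.closedBall 0 ρ with hK
  have hKc : IsCompact K := (isCompact_closedBall _ _).prod (isCompact_closedBall _ _)
  have hx₀K : (x₀, x₀) ∈ K := by
    have : ‖x₀‖ ≤ ρ := by linarith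
    simp [hK, this]
  have hmax : ∀ j : ℕ, ∃ p ∈ K, IsMaxOn (fun p => F p - ((j : ℝ) + 1) * ‖p.1 - p.2‖ ^ 2) K p := by
    intro j
    refine UpperSemicontinuousOn.exists_isMaxOn ⟨_, hx₀K⟩ hKc ?_
    have h1 : UpperSemicontinuous fun p : FracMA.E n × FracMA.E n =>
        -(((j : ℝ) + 1) * ‖p.1 - p.2‖ ^ 2) :=
      Continuous.upperSemicontinuous (by fun_prop)
    have h2 := hFusc.add h1
    simp only [← sub_eq_add_neg] at h2
    exact h2.upperSemicontinuousOn K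
  choose p hpK hp using hmax
  have hlow : ∀ j, m ≤ F (p j) - ((j : ℝ) + 1) * ‖(p j).1 - (p j).2‖ ^ 2 := fun j => by
    have h1 := hp j hx₀K
    simp only [Set.mem_ofPred_eq, sub_self, norm_zero] at h1
    have h2 : m ≤ F (x₀, x₀) := by
      simp only [hF]
      linarith [(hθh x₀).1]
    linarith
  have hmF : ∀ j, m ≤ F (p j) := fun j => (hlow j).trans (by
    have : 0 ≤ ((j : ℝ) + 1) * ‖(p j).1 - (p j).2‖ ^ 2 := by positivity
    linarith)
  have hnorm : ∀ j, ‖(p j).1‖ ≤ ρ ∧ ‖(p j).2‖ ≤ ρ := fun j => by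
    have := hpK j
    simpa [hK] using this
  obtain ⟨B, hB⟩ := (hFusc.upperSemicontinuousOn K).bddAbove_of_isCompact hKc
  -- As `v` is only semicontinuous, its values along the sequence need their own compactness; the
  -- upper bound comes from `v < u` at the maximum points.
  have hvIcc : ∀ j, v (p j).2 ∈ Set.Icc (-(C * (1 + ρ))) (C * (1 + ρ)) := fun j => by
    have h1 := hv_ge (p j).2
    have h2 := hu_le (p j).1
    have h3 : C * (1 + ‖(p j).2‖) ≤ C * (1 + ρ) := by gcongr; exact (hnorm j).2
    have h4 : C * (1 + ‖(p j).1‖) ≤ C * (1 + ρ) := by gcongr; exact (hnorm j).1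
    have h5 := hmF j
    simp only [hF] at h5
    exact ⟨by linarith, by linarith [(hθh (p j).1).2]⟩
  obtain ⟨⟨⟨a, b⟩, t⟩, -, σ, hσ, hσlim⟩ := (hKc.prod isCompact_Icc).tendsto_subseq
    (x := fun j => (p j, v (p j).2)) fun j => ⟨hpK j, hvIcc j⟩
  have hlimp : Tendsto (fun j => p (σ j)) atTop (𝓝 (a, b)) :=
    (continuous_fst.tendsto _).comp hσlim
  have hlim1 : Tendsto (fun j => (p (σ j)).1) atTop (𝓝 a) :=
    (continuous_fst.tendsto _).comp hlimp
  have hlim2 : Tendsto (fun j => (p (σ j)).2) atTop (𝓝 b) :=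
    (continuous_snd.tendsto _).comp hlimp
  have hlimv : Tendsto (fun j => v (p (σ j)).2) atTop (𝓝 t) :=
    (continuous_snd.tendsto _).comp hσlim
  have hdist : Tendsto (fun j => ‖(p j).1 - (p j).2‖ ^ 2) atTop (𝓝 0) := by
    have h0 : Tendsto (fun j : ℕ => (B - m) * (1 / ((j : ℝ) + 1))) atTop (𝓝 0) := by
      simpa using (tendsto_one_div_add_atTop_nhds_zero_nat (𝕜 := ℝ)).const_mul (B - m)
    refine squeeze_zero (fun j => by positivity) (fun j => ?_) h0
    have h1 := hlow j
    have h2 : F (p j) ≤ B := hB (Set.mem_image_of_mem F (hpK j))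
    have hj : 0 < (j : ℝ) + 1 := by positivity
    rw [mul_one_div, le_div_iff₀ hj]
    linarith
  have hab : a = b := by
    have h1 : Tendsto (fun j => ‖(p (σ j)).1 - (p (σ j)).2‖ ^ 2) atTop (𝓝 (‖a - b‖ ^ 2)) :=
      ((hlim1.sub hlim2).norm).pow 2
    have h2 := tendsto_nhds_unique h1 (hdist.comp hσ.tendsto_atTop)
    exact sub_eq_zero.1 (norm_eq_zero.1 (pow_eq_zero_iff (two_ne_zero)|>.1 h2))
  subst hab
  -- Outside the ball `F(a, a) ≤ m/4 + m/4 < m`, and semicontinuity would carry this to nearby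
  -- maximum points.
  have haR : ‖a‖ < R := by
    by_contra! h
    have h1 : F (a, a) < m := by
      simp only [hF]
      linarith [hfar a h, (hθh a).2]
    obtain ⟨j, hj⟩ := (hlimp.eventually (hFusc (a, a) m h1)).exists
    exact absurd (hmF (σ j)) (not_le.2 hj)
  -- Both sides carry the same second argument `v(y)`, so in the limit the `g` terms cancel,
  -- whatever the relation of `t` to `v a`.
  have hineq : ∀ᶠ j in atTop, g (p (σ j)).1 (v (p (σ j)).2) + μ * (3 * m / 4) ≤
      g (p (σ j)).2 (v (p (σ j)).2) := by
    filter_upwards [hlim1.norm.eventually_lt_const haR, hlim2.norm.eventually_lt_const haR]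
      with j hj1 hj2
    have h1 := hmF (σ j)
    simp only [hF] at h1
    have h2 : 3 * m / 4 ≤ u (p (σ j)).1 - v (p (σ j)).2 := by linarith [(hθh (p (σ j)).1).2]
    have h3 := hρ ((σ j : ℝ) + 1) (p (σ j)).1 (p (σ j)).2 (by positivity) hj1 hj2 (by linarith)
      fun c d hc hd => hp (σ j) (show (c, d) ∈ K by simp [hK, hc, hd])
    have h4 := hmono (p (σ j)).1 _ _ (show v (p (σ j)).2 ≤ u (p (σ j)).1 by linarith)
    have h5 := mul_le_mul_of_nonneg_left h2 hμ.le
    linarith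
  have hl1 : Tendsto (fun j => g (p (σ j)).1 (v (p (σ j)).2) + μ * (3 * m / 4)) atTop
      (𝓝 (g a t + μ * (3 * m / 4))) :=
    ((hg.tendsto (a, t)).comp (hlim1.prodMk_nhds hlimv)).add_const _
  have hl2 : Tendsto (fun j => g (p (σ j)).2 (v (p (σ j)).2)) atTop (𝓝 (g a t)) :=
    (hg.tendsto (a, t)).comp (hlim2.prodMk_nhds hlimv)
  have hle := le_of_tendsto_of_tendsto hl1 hl2 hineq
  have : 0 < μ * (3 * m / 4) := by positivity
  linarith
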